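/- Let $d\ge 1$, let $\nu$ be a probability measure on $\mathbb{R}^d$ that is absolutely continuous with respect to Lebesgue measure and satisfies $\int\|x\|\,d\nu(x)<\infty$, let $X=(X_1,\dots,X_d)$ have law $\nu$, and let $x_1,x_2,\dots$ be independent random vectors with law $\nu$. Let $i_1\ge 1$. For a probability measure $\mu$ on $\mathbb{R}$ put $Q_\mu(t)=\inf\{x\in\mathbb{R}:\mu((-\infty,x])\ge t\}$; $Q_{X_k}$ and $Q_{X_k|A}$ denote the quantile functions of the law of $X_k$ and of its conditional law given $A$. For $r\ge1$ let $L_r(t)=\sum_{k=0}^{r-1}(-1)^k\binom{r-1}{k}^2t^{r-1-k}(1-t)^k$ be the shifted Legendre polynomials and $L_{(i_1,\dots,i_d)}(u)=\prod_{k=1}^d L_{i_k}(u_k)$. The Rosenblatt quantile $Q=(Q_1,\dots,Q_d)$ of a probability measure on $\mathbb{R}^d$ (the law of $(X_1,\dots,X_d)$) is defined on $[0,1]^d$ recursively by $$Q_1(u)=Q_{X_1}(u_1),\qquad Q_k(u)=Q_{X_k|X_1=Q_1(u),\dots,X_{k-1}=Q_{k-1}(u)}(u_k)\quad(2\le k\le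 d),$$ and the L-moments of $\nu$ associated with it are $\lambda_\alpha=\int_{[0,1]^d}Q(u)L_\alpha(u)\,du\in\mathbb{R}^d$. Let also $$Q^{(1)}(u)=\bigl(Q_{X_1}(u_1),\,Q_{X_2|X_1=Q_{X_1}(u_1)}(u_2),\,\dots,\,Q_{X_d|X_1=Q_{X_1}(u_1)}(u_d)\bigr).$$ For $n\ge1$ let $Q_n$ be the Rosenblatt quantile of the empirical measure $\nu_n=\frac1n\sum_{i=1}^n\delta_{x_i}$, and let $x^{(1)}_{(1:n)},\dots,x^{(1)}_{(n:n)}$ be the sample $x_1,\dots,x_n$ sorted by increasing first coordinate. Consider the plug-in estimator and the unbiased (Serfling–Xiao) estimator $$\hat\lambda_{(i_1,1,\dots,1)}=\int_{[0,1]^d}Q_n(u)L_{(i_1,1,\dots,1)}(u)\,du,\qquad \hat\lambda^{(u)}_{(i_1,1,\dots,1)}=\frac1n\sum_{i=1}^n v_i^{(i_1)}x^{(1)}_{(i:n)},$$ $$v_i^{(i_1)}=\sum_{j=0}^{\min(i-1,i_1-1)}(-1)^{i_1-1-j}\binom{i_1-1}{j}\binom{i_1-1+j}{j}\binom{n-1}{j}^{-1}\binom{i-1}{j}.$$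 Then the integrals defining the L-moments of multi-index $(i_1,1,\dots,1)$ of $Q^{(1)}$, of $Q$ and, almost surely for all $n\ge1$, of $Q_n$ converge absolutely, and, as $n\to\infty$, $$\hat\lambda_{(i_1,1,\dots,1)}\xrightarrow{a.s.}\int_{[0,1]^d}Q^{(1)}(u)L_{(i_1,1,\dots,1)}(u)\,du,\qquad \hat\lambda^{(u)}_{(i_1,1,\dots,1)}\xrightarrow{a.s.}\int_{[0,1]^d}Q^{(1)}(u)L_{(i_1,1,\dots,1)}(u)\,du,$$ and this limit is the Rosenblatt L-moment: $$\int_{[0,1]^d}Q^{(1)}(u)L_{(i_1,1,\dots,1)}(u)\,du=\lambda_{(i_1,1,\dots,1)}$$ (in particular in the bivariate case $d=2$). -/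

import Mathlib

open MeasureTheory ProbabilityTheory Filter Topology
open scoped ENNReal

namespace LMoment

/-- The (generalized inverse) quantile function of a probability measure on the line:
`Q(t) = inf {x : μ((-∞, x]) ≥ t}`. -/
noncomputable def quantile (μ : Measure ℝ) (t : ℝ) : ℝ :=
  sInf {x : ℝ | t ≤ μ.real (Set.Iic x)}

/-- The shifted Legendre polynomial `L_r` (`r ≥ 1`, of degree `r - 1`, with `L_r(1) = 1`). -/
noncomputable def legendre (r : ℕ) (t : ℝ) : ℝ :=
  ∑ k ∈ Finset.range r,
    (-1 : ℝ) ^ k * ((r - 1).choose k : ℝ) ^ 2 * t ^ (r - 1 - k) * (1 - t) ^ k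

/-- The product Legendre polynomial `L_α(u) = ∏ k, L_{α k}(u k)`. -/
noncomputable def legendreProd {d : ℕ} (α : Fin d → ℕ) (u : Fin d → ℝ) : ℝ :=
  ∏ k, legendre (α k) (u k)

/-- The unit cube `[0,1]^d`. -/
def cube (d : ℕ) : Set (Fin d → ℝ) := Set.Icc 0 1

/-- The L-moment of multi-index `α` of a map `Q : [0,1]^d → ℝ^d`. -/
noncomputable def lMoment {d : ℕ} (Q : (Fin d → ℝ) → (Fin d → ℝ)) (α : Fin d → ℕ) : Fin d → ℝ :=
  ∫ u in cube d, legendreProd α u • Q u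

/-- The integral defining the L-moment of multi-index `α` of `Q` converges absolutely. -/
def HasLMoment {d : ℕ} (Q : (Fin d → ℝ) → (Fin d → ℝ)) (α : Fin d → ℕ) : Prop :=
  IntegrableOn (fun u => legendreProd α u • Q u) (cube d)

/-- The multi-index `(r, 1, …, 1)`. -/
def firstIndex (d : ℕ) [NeZero d] (r : ℕ) : Fin d → ℕ := fun k => if k = 0 then r else 1

/-- The Rosenblatt quantile of a measure `ν` on `ℝ^d`. Its `k`-th coordinate at `u` is the quantile
at `u k` of the conditional law of the `k`-th coordinate given that the coordinates `j < k` are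
equal to the values `Q_j(u)` already constructed. For the first coordinate the conditioning is on
an empty family, so it is the quantile of the first marginal. -/
noncomputable def rosenblattQuantile {d : ℕ} (ν : Measure (Fin d → ℝ)) [IsFiniteMeasure ν]
    (u : Fin d → ℝ) (k : Fin d) : ℝ :=
  quantile
    (condDistrib (fun x : Fin d → ℝ => x k) (fun x (j : {j : Fin d // j < k}) => x j.1) ν
      (fun j => rosenblattQuantile ν u j.1))
    (u k)
termination_by k
decreasing_by exact j.2

/-- The map `Q⁽¹⁾`, built from the first marginal and from the conditional laws of the other
coordinates given the first one only. -/
noncomputable def quantileGivenFirst {d : ℕ} [NeZero d] (ν : Measure (Fin d → ℝ))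
    [IsFiniteMeasure ν] (u : Fin d → ℝ) (k : Fin d) : ℝ :=
  if k = 0 then quantile (ν.map fun x => x 0) (u 0)
  else
    quantile
      (condDistrib (fun x : Fin d → ℝ => x k) (fun x => x 0) ν
        (quantile (ν.map fun x => x 0) (u 0)))
      (u k)

/-- The empirical measure `(1/n) ∑ δ_{x_i}` of `n` points. -/
noncomputable def empiricalMeasure {d n : ℕ} (x : Fin n → Fin d → ℝ) : Measure (Fin d → ℝ) :=
  (n : ℝ≥0∞)⁻¹ • ∑ i, Measure.dirac (x i)

instance isFiniteMeasure_empiricalMeasure {d n : ℕ} (x : Fin n → Fin d → ℝ) : IsFiniteMeasure (empiricalMeasure x) := by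
  refine ⟨?_⟩
  rcases Nat.eq_zero_or_pos n with rfl | hn
  · simp [empiricalMeasure]
  · have h0 : (n : ℝ≥0∞) ≠ 0 := by exact_mod_cast hn.ne'
    simp [empiricalMeasure, ENNReal.inv_mul_cancel h0 (ENNReal.natCast_ne_top n)]

/-- The plug-in estimator: the L-moment of the Rosenblatt quantile of the empirical measure. -/
noncomputable def plugInLMoment {d n : ℕ} (x : Fin n → Fin d → ℝ) (α : Fin d → ℕ) : Fin d → ℝ :=
  lMoment (rosenblattQuantile (empiricalMeasure x)) α

/-- The `n` points sorted by increasing first coordinate (position `i : Fin n` holds the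
`(i+1)`-th point). -/
noncomputable def sortedByFirst {d n : ℕ} [NeZero d] (x : Fin n → Fin d → ℝ) (i : Fin n) : Fin d → ℝ :=
  x (Tuple.sort (fun l => x l 0) i)

/-- The weight of the `(i+1)`-th sorted point in the unbiased estimator of order `r`
(`i` is counted from `0`). -/
noncomputable def unbiasedWeight (r n i : ℕ) : ℝ :=
  ∑ j ∈ Finset.range (min i (r - 1) + 1),
    (-1 : ℝ) ^ (r - 1 - j) * ((r - 1).choose j : ℝ) * ((r - 1 + j).choose j : ℝ)
      * ((n - 1).choose j : ℝ)⁻¹ * (i.choose j : ℝ)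

/-- The unbiased estimator of the L-moment of multi-index `(r, 1, …, 1)`. -/
noncomputable def unbiasedLMoment {d n : ℕ} [NeZero d] (x : Fin n → Fin d → ℝ) (r : ℕ) :
    Fin d → ℝ :=
  (n : ℝ)⁻¹ • ∑ i : Fin n, unbiasedWeight r n i • sortedByFirst x i

end LMoment

/-! Since `legendre 1 = 1`, the polynomial of index `(r, 1, …, 1)` depends on `u 0` only. Hence the
L-moment sees just the pair laws of `(Q u 0, Q u k)` and the way `Q u 0` depends on `u 0`. Both the
Rosenblatt quantile and `quantileGivenFirst` have first coordinate the marginal quantile of `u 0`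
and reproduce the laws of `(X₀, X_k)`; this is recorded in `IsTransport`. If `X₀` has no atoms and
distribution function `F`, then `F (Q u 0) = u 0` almost everywhere, so both L-moments equal
`E[L_r(F(X₀)) X]` (`IsTransport.lMoment_eq`).

For the empirical measure the identity `F_n (Q u 0) = u 0` fails by at most the largest atom of its
first marginal, almost surely `1/n`. As `L_r` is Lipschitz on `[0,1]`, the plug-in estimator is
within `O(1/n)` of the average of `L_r(F_n(x_i 0)) x_i` (`IsTransport.abs_lMoment_sub_le`). The
unbiased weights are uniformly `o(1)`-close to `L_r` at `(rank of x_i 0)/n = F_n(x_i 0)`, so that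
estimator is close to the same average. Glivenko–Cantelli replaces `F_n` by `F`, and the strong law
gives the limit `E[L_r(F(X₀)) X]`. -/

namespace LMoment

/-! ### Quantile functions on the line -/

section Quantile

variable {μ : Measure ℝ} [IsProbabilityMeasure μ] {t x : ℝ}

theorem monotone_real_Iic (μ : Measure ℝ) [IsProbabilityMeasure μ] :
    Monotone fun x => μ.real (Set.Iic x) := fun _ _ h =>
  measureReal_mono (Set.Iic_subset_Iic.2 h)

theorem exists_nat_le_real_Iic (ht : t < 1) : ∃ n : ℕ, t ≤ μ.real (Set.Iic (n : ℝ)) := by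
  have h := (tendsto_cdf_atTop μ).comp tendsto_natCast_atTop_atTop
  obtain ⟨n, hn⟩ := (h.eventually (lt_mem_nhds ht)).exists
  exact ⟨n, by simpa [cdf_eq_real] using le_of_lt hn⟩

theorem bddBelow_setOf_le_real_Iic (ht : 0 < t) :
    BddBelow {x : ℝ | t ≤ μ.real (Set.Iic x)} := by
  obtain ⟨a, ha⟩ := ((tendsto_cdf_atBot μ).eventually (gt_mem_nhds ht)).exists
  refine ⟨a, fun y hy => ?_⟩
  by_contra! h
  rw [cdf_eq_real] at ha
  exact absurd (le_trans hy (monotone_real_Iic μ h.le)) (not_le.2 ha)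

/-- Right-continuity of the distribution function makes the infimum attained. Nonemptiness is
assumed instead of `t < 1`, so that measurability can be proved without restricting the level. -/
theorem quantile_le_iff_of_nonempty (ht : 0 < t) (hne : ∃ z, t ≤ μ.real (Set.Iic z)) :
    quantile μ t ≤ x ↔ t ≤ μ.real (Set.Iic x) := by
  constructor
  · intro h
    have hq : ∀ y, quantile μ t < y → t ≤ μ.real (Set.Iic y) := fun y hy => by
      obtain ⟨z, hz, hzy⟩ := exists_lt_of_csInf_lt hne hy
      exact le_trans hz (monotone_real_Iic μ hzy.le)
    have hc : Tendsto (cdf μ) (𝓝[>] x) (𝓝 (cdf μ x)) :=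
      ((cdf μ).right_continuous x).mono_left (nhdsWithin_mono _ Set.Ioi_subset_Ici_self)
    rw [← cdf_eq_real]
    refine ge_of_tendsto hc ?_
    filter_upwards [self_mem_nhdsWithin] with y hy
    rw [cdf_eq_real]
    exact hq y (h.trans_lt hy)
  · exact fun h => csInf_le (bddBelow_setOf_le_real_Iic ht) h

theorem quantile_le_iff (ht : 0 < t) (ht1 : t < 1) :
    quantile μ t ≤ x ↔ t ≤ μ.real (Set.Iic x) :=
  quantile_le_iff_of_nonempty ht ((exists_nat_le_real_Iic ht1).imp' _ fun _ h => h)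

theorem le_real_Iic_quantile (ht : 0 < t) (ht1 : t < 1) :
    t ≤ μ.real (Set.Iic (quantile μ t)) :=
  (quantile_le_iff ht ht1).1 le_rfl

theorem real_Iio_quantile_le (ht : 0 < t) (ht1 : t < 1) :
    μ.real (Set.Iio (quantile μ t)) ≤ t := by
  obtain ⟨u, hu, hlt, hlim⟩ := exists_seq_strictMono_tendsto (quantile μ t)
  have hU : ⋃ n, Set.Iic (u n) = Set.Iio (quantile μ t) := by
    ext y
    simp only [Set.mem_iUnion, Set.mem_Iic, Set.mem_Iio]
    exact ⟨fun ⟨n, hn⟩ => hn.trans_lt (hlt n), fun hy =>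
      ((hlim.eventually (lt_mem_nhds hy)).exists).imp fun _ h => h.le⟩
  have h := tendsto_measure_iUnion_atTop (μ := μ) (s := fun n => Set.Iic (u n))
    (fun _ _ h => Set.Iic_subset_Iic.2 (hu.monotone h))
  rw [hU] at h
  refine le_of_tendsto ((ENNReal.tendsto_toReal (measure_ne_top _ _)).comp h)
    (Eventually.of_forall fun n => ?_)
  by_contra! hn
  exact absurd ((quantile_le_iff ht ht1).2 hn.le) (not_le.2 (hlt n))

theorem real_Iic_quantile_le (ht : 0 < t) (ht1 : t < 1) :
    μ.real (Set.Iic (quantile μ t)) ≤ t + μ.real {quantile μ t} := by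
  have h : Set.Iic (quantile μ t) = Set.Iio (quantile μ t) ∪ {quantile μ t} := by
    rw [Set.union_comm, Set.singleton_union, Set.Iio_insert]
  rw [h]
  exact (measureReal_union_le _ _).trans (by gcongr; exact real_Iio_quantile_le ht ht1)

theorem real_Iic_quantile [NullSingletonClass μ] (ht : 0 < t) (ht1 : t < 1) :
    μ.real (Set.Iic (quantile μ t)) = t :=
  le_antisymm (by simpa [measureReal_def] using real_Iic_quantile_le (μ := μ) ht ht1) (le_real_Iic_quantile ht ht1)

/-- The defining set is then either empty or all of `ℝ`, and `sInf` takes the default value `0` in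
both cases. -/
theorem quantile_eq_zero (h : ¬(0 < t ∧ ∃ n : ℕ, t ≤ μ.real (Set.Iic (n : ℝ)))) :
    quantile μ t = 0 := by
  unfold quantile
  by_cases ht : 0 < t
  · have hS : {x : ℝ | t ≤ μ.real (Set.Iic x)} = ∅ := by
      refine Set.eq_empty_of_forall_notMem fun y hy => h ⟨ht, ?_⟩
      obtain ⟨n, hn⟩ := exists_nat_ge y
      exact ⟨n, le_trans hy (monotone_real_Iic μ hn)⟩
    rw [hS, Real.sInf_empty]
  · have hS : {x : ℝ | t ≤ μ.real (Set.Iic x)} = Set.univ :=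
      Set.eq_univ_of_forall fun y => (not_lt.1 ht).trans measureReal_nonneg
    rw [hS, Real.sInf_univ]

end Quantile

/-- The uniform law on the unit interval. -/
noncomputable abbrev uniform : Measure ℝ := volume.restrict (Set.Icc 0 1)

instance isProbabilityMeasure_uniform : IsProbabilityMeasure uniform :=
  ⟨by simp [uniform]⟩

theorem ae_uniform : ∀ᵐ t ∂uniform, 0 < t ∧ t < 1 := by
  rw [uniform, ← restrict_Ioo_eq_restrict_Icc]
  exact ae_restrict_mem measurableSet_Ioo

/-! ### Sampling a kernel by quantiles -/

section Kernel

variable {α : Type*} [MeasurableSpace α] {κ : Kernel α ℝ} [IsMarkovKernel κ]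

theorem measurable_kernel_real_Iic (κ : Kernel α ℝ) (x : ℝ) :
    Measurable fun a => (κ a).real (Set.Iic x) :=
  (κ.measurable_coe measurableSet_Iic).ennreal_toReal

/-- On the set `G` of positive, attained levels the quantile is governed by
`quantile_le_iff_of_nonempty`; off `G` it is `0`. Quantifying over natural thresholds keeps `G` a
countable union. -/
theorem measurable_quantile_kernel (κ : Kernel α ℝ) [IsMarkovKernel κ] :
    Measurable fun p : α × ℝ => quantile (κ p.1) p.2 := by
  refine measurable_of_Iic fun x => ?_
  set G : Set (α × ℝ) :=
    {p | 0 < p.2} ∩ ⋃ n : ℕ, {p | p.2 ≤ (κ p.1).real (Set.Iic (n : ℝ))} with hG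
  have hle : ∀ y : ℝ, MeasurableSet {p : α × ℝ | p.2 ≤ (κ p.1).real (Set.Iic y)} := fun y =>
    measurableSet_le measurable_snd ((measurable_kernel_real_Iic κ y).comp measurable_fst)
  have hGm : MeasurableSet G :=
    (measurableSet_lt measurable_const measurable_snd).inter (MeasurableSet.iUnion fun n => hle n)
  have : (fun p : α × ℝ => quantile (κ p.1) p.2) ⁻¹' Set.Iic x
      = (G ∩ {p | p.2 ≤ (κ p.1).real (Set.Iic x)}) ∪ (Gᶜ ∩ {_p | 0 ≤ x}) := by
    ext p
    by_cases hp : p ∈ G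
    · have hp' := hp
      simp only [hG, Set.mem_inter_iff, Set.mem_ofPred_eq, Set.mem_iUnion] at hp'
      obtain ⟨h0, n, hn⟩ := hp'
      simp [hp, quantile_le_iff_of_nonempty h0 ⟨n, hn⟩]
    · have h0 : quantile (κ p.1) p.2 = 0 := quantile_eq_zero fun h => hp (by simpa [hG] using h)
      simp [hp, h0]
  rw [this]
  exact (hGm.inter (hle x)).union (hGm.compl.inter (MeasurableSet.const _))

theorem measurable_quantile (μ : Measure ℝ) [IsProbabilityMeasure μ] : Measurable (quantile μ) :=
  (measurable_quantile_kernel (Kernel.const Unit μ)).comp (measurable_const.prodMk measurable_id)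
    (f := fun t : ℝ => ((), t))

theorem map_quantile_uniform (μ : Measure ℝ) [IsProbabilityMeasure μ] :
    uniform.map (quantile μ) = μ := by
  have := Measure.isProbabilityMeasure_map (μ := uniform) (measurable_quantile μ).aemeasurable
  refine Measure.ext_of_Iic _ _ fun x => ?_
  rw [Measure.map_apply (measurable_quantile μ) measurableSet_Iic]
  have h : quantile μ ⁻¹' Set.Iic x =ᵐ[uniform] Set.Iic (μ.real (Set.Iic x)) := by
    filter_upwards [ae_uniform] with t ht
    exact propext (quantile_le_iff ht.1 ht.2)
  have hI : Set.Iic (μ.real (Set.Iic x)) ∩ Set.Icc 0 1 = Set.Icc 0 (μ.real (Set.Iic x)) := by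
    ext y
    simp only [Set.mem_inter_iff, Set.mem_Iic, Set.mem_Icc]
    exact ⟨fun h => ⟨h.2.1, h.1⟩, fun h => ⟨h.2, h.1, h.2.trans measureReal_le_one⟩⟩
  rw [measure_congr h, uniform, Measure.restrict_apply measurableSet_Iic, hI]
  simp

theorem map_prod_quantile_uniform (ρ : Measure α) [IsFiniteMeasure ρ] (κ : Kernel α ℝ)
    [IsMarkovKernel κ] :
    (ρ.prod uniform).map (fun p => (p.1, quantile (κ p.1) p.2)) = ρ ⊗ₘ κ := by
  have hm : Measurable fun p : α × ℝ => (p.1, quantile (κ p.1) p.2) :=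
    measurable_fst.prodMk (measurable_quantile_kernel κ)
  ext s hs
  rw [Measure.map_apply hm hs, Measure.prod_apply (hm hs), Measure.compProd_apply hs]
  refine lintegral_congr fun a => ?_
  conv_rhs => rw [← map_quantile_uniform (κ a)]
  rw [Measure.map_apply (measurable_quantile _) (measurable_prodMk_left hs)]
  rfl

end Kernel

/-- Sampling a conditional law by its quantile function yields the joint law. -/
theorem map_pair_quantile_condDistrib {Ω α E : Type*} [MeasurableSpace Ω] [MeasurableSpace α]
    [MeasurableSpace E] {P : Measure Ω} [IsProbabilityMeasure P] {ν : Measure E}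
    [IsFiniteMeasure ν] {Y : Ω → α} {U : Ω → ℝ} {A : E → α} {B : E → ℝ}
    (hY : Measurable Y) (hU : Measurable U) (hB : Measurable B) (hYlaw : P.map Y = ν.map A)
    (hUlaw : P.map U = uniform) (hind : IndepFun Y U P) :
    P.map (fun ω => (Y ω, quantile (condDistrib B A ν (Y ω)) (U ω)))
      = ν.map (fun x => (A x, B x)) := by
  have h := (indepFun_iff_map_prod_eq_prod_map_map hY.aemeasurable hU.aemeasurable).1 hind
  rw [← compProd_map_condDistrib hB.aemeasurable,
    ← map_prod_quantile_uniform (ν.map A) (condDistrib B A ν), ← hYlaw, ← hUlaw, ← h,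
    Measure.map_map (measurable_fst.prodMk (measurable_quantile_kernel _)) (hY.prodMk hU)]
  rfl

/-! ### Uniform law on the cube and independence of coordinates -/

section Cube

variable {d : ℕ}

theorem volume_restrict_cube : volume.restrict (cube d) = Measure.pi fun _ : Fin d => uniform := by
  rw [cube, ← Set.pi_univ_Icc, volume_pi, Measure.restrict_pi_pi]
  rfl

instance isProbabilityMeasure_cube : IsProbabilityMeasure (volume.restrict (cube d)) := by
  rw [volume_restrict_cube]; infer_instance

theorem map_eval_cube (k : Fin d) : (volume.restrict (cube d)).map (fun u => u k) = uniform := by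
  rw [volume_restrict_cube]
  exact (measurePreserving_eval (fun _ : Fin d => uniform) k).map_eq

theorem ae_cube (k : Fin d) : ∀ᵐ u ∂volume.restrict (cube d), 0 < u k ∧ u k < 1 := by
  have h := ae_uniform
  rw [← map_eval_cube k] at h
  exact ae_of_ae_map (measurable_pi_apply k).aemeasurable h

theorem iIndepFun_cube :
    iIndepFun (fun (k : Fin d) (u : Fin d → ℝ) => u k) (volume.restrict (cube d)) := by
  rw [volume_restrict_cube]
  exact iIndepFun_pi (X := fun _ t => t) fun _ => aemeasurable_id

/-- A function of the coordinates in `S` is independent of a coordinate outside `S`. -/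
theorem indepFun_cube_of_dependsOn {β : Type*} [MeasurableSpace β] {f : (Fin d → ℝ) → β}
    (hf : Measurable f) {S : Finset (Fin d)} (hS : ∀ u v, (∀ j ∈ S, u j = v j) → f u = f v)
    {k : Fin d} (hk : k ∉ S) :
    IndepFun f (fun u => u k) (volume.restrict (cube d)) := by
  classical
  have h := iIndepFun_cube.indepFun_finset S {k} (Finset.disjoint_singleton_right.2 hk)
    fun i => measurable_pi_apply i
  -- Extension by zero exhibits `f` as a measurable function of the coordinates in `S`.
  let e : (S → ℝ) → (Fin d → ℝ) := fun y j => if hj : j ∈ S then y ⟨j, hj⟩ else 0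
  have he : Measurable e := by
    refine measurable_pi_iff.2 fun j => ?_
    by_cases hj : j ∈ S
    · simpa [e, hj] using measurable_pi_apply _
    · simp [e, hj]
  have hk' : Measurable fun y : ({k} : Finset (Fin d)) → ℝ => y ⟨k, Finset.mem_singleton_self k⟩ :=
    measurable_pi_apply _
  have h' := h.comp (φ := fun y => f (e y)) (hf.comp he) hk'
  have hfe : f = (fun y => f (e y)) ∘ fun (u : Fin d → ℝ) (i : S) => u i :=
    funext fun u => hS _ _ fun j hj => by simp [e, hj]
  rw [hfe]
  exact h'

end Cube

/-! ### Transport properties of the two quantile maps -/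

section Rosenblatt

variable {d : ℕ} (ν : Measure (Fin d → ℝ)) [IsProbabilityMeasure ν]

theorem measurable_rosenblattQuantile_apply (k : Fin d) :
    Measurable fun u => rosenblattQuantile ν u k := by
  induction k using WellFoundedLT.induction with
  | ind k ih =>
    have h : Measurable fun (u : Fin d → ℝ) (j : {j : Fin d // j < k}) =>
        rosenblattQuantile ν u j.1 := measurable_pi_iff.2 fun j => ih j.1 j.2
    simp_rw [rosenblattQuantile.eq_1 ν _ k]
    exact (measurable_quantile_kernel _).comp (h.prodMk (measurable_pi_apply k))

theorem measurable_rosenblattQuantile : Measurable (rosenblattQuantile ν) :=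
  measurable_pi_iff.2 (measurable_rosenblattQuantile_apply ν)

theorem rosenblattQuantile_congr {u v : Fin d → ℝ} (k : Fin d) (h : ∀ j ≤ k, u j = v j) :
    rosenblattQuantile ν u k = rosenblattQuantile ν v k := by
  induction k using WellFoundedLT.induction with
  | ind k ih =>
    rw [rosenblattQuantile.eq_1 ν u k, rosenblattQuantile.eq_1 ν v k, h k le_rfl]
    congr 2
    exact funext fun j => ih j.1 j.2 fun i hi => h i (hi.trans j.2.le)

/-- Induction on the number of coordinates: those already built depend only on `u j` with `j < m`,
hence are independent of `u m`, and sampling the conditional law with `u m` extends the joint law by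
one coordinate. -/
theorem map_rosenblattQuantile_initial (m : ℕ) (hm : m ≤ d) :
    (volume.restrict (cube d)).map
        (fun u (j : {j : Fin d // j.1 < m}) => rosenblattQuantile ν u j.1)
      = ν.map fun x j => x j.1 := by
  induction m with
  | zero =>
    have hE : IsEmpty {j : Fin d // j.1 < 0} := ⟨fun j => absurd j.2 (Nat.not_lt_zero _)⟩
    have h1 : ∀ (P : Measure (Fin d → ℝ)) [IsProbabilityMeasure P]
        (f : (Fin d → ℝ) → {j : Fin d // j.1 < 0} → ℝ),
        P.map f = Measure.dirac fun j => hE.elim j := fun P _ f => by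
      rw [show f = fun _ j => hE.elim j from funext fun _ => Subsingleton.elim _ _]
      simp
    rw [h1, h1]
  | succ m ih =>
    have hmd : m < d := hm
    set k : Fin d := ⟨m, hmd⟩ with hk
    have hY : Measurable fun (u : Fin d → ℝ) (j : {j : Fin d // j < k}) =>
        rosenblattQuantile ν u j.1 :=
      measurable_pi_iff.2 fun j => measurable_rosenblattQuantile_apply ν j.1
    have hA : Measurable fun (x : Fin d → ℝ) (j : {j : Fin d // j < k}) => x j.1 :=
      measurable_pi_iff.2 fun j => measurable_pi_apply j.1
    have hind : IndepFun (fun (u : Fin d → ℝ) (j : {j : Fin d // j < k}) =>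
        rosenblattQuantile ν u j.1) (fun u => u k) (volume.restrict (cube d)) := by
      refine indepFun_cube_of_dependsOn hY (S := Finset.Iio k) (fun u v huv => ?_) (by simp)
      exact funext fun j => rosenblattQuantile_congr ν j.1 fun i hi =>
        huv i (Finset.mem_Iio.2 (hi.trans_lt j.2))
    -- The induction hypothesis is stated over `j.1 < m`, which unfolds to `j < k`.
    have hpair := map_pair_quantile_condDistrib hY (measurable_pi_apply k)
      (measurable_pi_apply k) (ih hmd.le) (map_eval_cube k) hind
    have hpair' : (volume.restrict (cube d)).map (fun u =>
        ((fun (j : {j : Fin d // j < k}) => rosenblattQuantile ν u j.1),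
          rosenblattQuantile ν u k)) = ν.map fun x => ((fun j => x j.1), x k) := by
      refine Eq.trans ?_ hpair
      congr 1
      exact funext fun u => Prod.ext rfl (rosenblattQuantile.eq_1 ν u k)
    -- Appends the new coordinate to the old ones, turning the pair law into the law of `m + 1`
    -- coordinates.
    let e : ({j : Fin d // j < k} → ℝ) × ℝ → ({j : Fin d // j.1 < m + 1} → ℝ) := fun p j =>
      if h : j.1 < k then p.1 ⟨j.1, h⟩ else p.2
    have he : Measurable e := by
      refine measurable_pi_iff.2 fun j => ?_
      by_cases h : j.1 < k
      · simp only [e, h, dite_true]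
        exact (measurable_pi_apply (⟨j.1, h⟩ : {j : Fin d // j < k})).comp measurable_fst
      · simpa [e, h] using measurable_snd
    have hcomp : ∀ x : Fin d → ℝ, (fun j : {j : Fin d // j.1 < m + 1} => x j.1)
        = e ((fun j => x j.1), x k) := fun x => by
      funext j
      by_cases h : j.1 < k
      · simp [e, h]
      · have : j.1 = k := le_antisymm (Nat.lt_succ_iff.1 j.2) (not_lt.1 h)
        simp [e, this]
    have h2 := congrArg (Measure.map e) hpair'
    rw [Measure.map_map he (hY.prodMk (measurable_rosenblattQuantile_apply ν k)),
      Measure.map_map he (hA.prodMk (measurable_pi_apply k))] at h2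
    calc _ = _ := by
          congr 1
          exact funext fun u => hcomp (rosenblattQuantile ν u)
      _ = _ := h2
      _ = _ := by
          congr 1
          exact (funext fun u => hcomp u).symm

/-- The Rosenblatt quantile transports the uniform law on the cube to `ν`. -/
theorem map_rosenblattQuantile :
    (volume.restrict (cube d)).map (rosenblattQuantile ν) = ν := by
  let e : ({j : Fin d // j.1 < d} → ℝ) → (Fin d → ℝ) := fun y j => y ⟨j, j.2⟩
  have he : Measurable e := measurable_pi_iff.2 fun j => measurable_pi_apply _
  have h := congrArg (Measure.map e) (map_rosenblattQuantile_initial ν d le_rfl)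
  rw [Measure.map_map he, Measure.map_map he] at h
  · exact h.trans Measure.map_id
  · exact measurable_pi_iff.2 fun j => measurable_pi_apply j.1
  · exact measurable_pi_iff.2 fun j => measurable_rosenblattQuantile_apply ν j.1

/-- A conditional law is in general fixed only almost everywhere; here the sole value is an atom of
mass one, so it is determined at that point. -/
theorem condDistrib_of_unique {E α : Type*} [MeasurableSpace E] [MeasurableSpace α] [Subsingleton α]
    [MeasurableSingletonClass α] {μ : Measure E} [IsProbabilityMeasure μ] {Y : E → ℝ}
    {Z : E → α} (hY : Measurable Y) (a : α) :
    condDistrib Y Z μ a = μ.map Y := by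
  have hZ : Measurable Z := measurable_of_subsingleton_codomain Z
  have hs : ({a} : Set α) = Set.univ := Set.eq_univ_of_forall fun b => Subsingleton.elim b a
  have h1 : μ.map Z {a} = 1 := by
    rw [hs, Measure.map_apply hZ MeasurableSet.univ]
    simp
  ext s hs'
  rw [condDistrib_apply_of_ne_zero hY a (by simp [h1]) s, h1,
    Measure.map_apply (hZ.prodMk hY) ((measurableSet_singleton a).prod hs'),
    Measure.map_apply hY hs', hs]
  simp [Set.mk_preimage_prod]

variable [NeZero d]

theorem rosenblattQuantile_zero (u : Fin d → ℝ) :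
    rosenblattQuantile ν u 0 = quantile (ν.map fun x => x 0) (u 0) := by
  have hE : IsEmpty {j : Fin d // j < 0} := ⟨fun j => absurd j.2 (Fin.not_lt_zero _)⟩
  rw [rosenblattQuantile.eq_1, condDistrib_of_unique (measurable_pi_apply 0)]

theorem quantileGivenFirst_zero (u : Fin d → ℝ) :
    quantileGivenFirst ν u 0 = quantile (ν.map fun x => x 0) (u 0) := by
  simp [quantileGivenFirst]

instance isProbabilityMeasure_map_eval (k : Fin d) :
    IsProbabilityMeasure (ν.map fun x => x k) :=
  Measure.isProbabilityMeasure_map (measurable_pi_apply k).aemeasurable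

theorem measurable_quantileGivenFirst_apply (k : Fin d) :
    Measurable fun u => quantileGivenFirst ν u k := by
  have h0 : Measurable fun u : Fin d → ℝ => quantile (ν.map fun x => x 0) (u 0) :=
    (measurable_quantile _).comp (measurable_pi_apply 0)
  by_cases hk : k = 0
  · simpa [quantileGivenFirst, hk] using h0
  · simp only [quantileGivenFirst, hk, if_false]
    exact (measurable_quantile_kernel _).comp (h0.prodMk (measurable_pi_apply k))

theorem measurable_quantileGivenFirst : Measurable (quantileGivenFirst ν) :=
  measurable_pi_iff.2 (measurable_quantileGivenFirst_apply ν)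

theorem map_quantile_eval_zero :
    (volume.restrict (cube d)).map (fun u => quantile (ν.map fun x => x 0) (u 0))
      = ν.map fun x => x 0 := by
  conv_rhs => rw [← map_quantile_uniform (ν.map fun x => x 0), ← map_eval_cube (0 : Fin d)]
  rw [Measure.map_map (measurable_quantile _) (measurable_pi_apply 0)]
  rfl

theorem map_pair_quantileGivenFirst (k : Fin d) :
    (volume.restrict (cube d)).map
        (fun u => (quantileGivenFirst ν u 0, quantileGivenFirst ν u k))
      = ν.map fun x => (x 0, x k) := by
  have h0 : Measurable fun u : Fin d → ℝ => quantile (ν.map fun x => x 0) (u 0) :=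
    (measurable_quantile _).comp (measurable_pi_apply 0)
  simp_rw [quantileGivenFirst_zero]
  by_cases hk : k = 0
  · subst hk
    simp_rw [quantileGivenFirst_zero]
    have h := congrArg (Measure.map fun t : ℝ => (t, t)) (map_quantile_eval_zero ν)
    have hdiag : Measurable fun t : ℝ => (t, t) := measurable_id.prodMk measurable_id
    rwa [Measure.map_map hdiag h0, Measure.map_map hdiag (measurable_pi_apply 0)] at h
  · have hind := indepFun_cube_of_dependsOn h0 (S := {0}) (k := k)
      (fun u v huv => by rw [huv 0 (by simp)]) (by simpa using hk)
    have h := map_pair_quantile_condDistrib h0 (measurable_pi_apply k) (measurable_pi_apply k)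
      (map_quantile_eval_zero ν) (map_eval_cube k) hind
    simpa [quantileGivenFirst, hk] using h

end Rosenblatt

/-! ### Bounds for shifted Legendre polynomials -/

section Legendre

theorem legendre_one (t : ℝ) : legendre 1 t = 1 := by simp [legendre]

theorem legendreProd_firstIndex {d : ℕ} [NeZero d] (r : ℕ) (u : Fin d → ℝ) :
    legendreProd (firstIndex d r) u = legendre r (u 0) := by
  rw [legendreProd, Finset.prod_eq_single 0]
  · simp [firstIndex]
  · intro k _ hk
    simp [firstIndex, hk, legendre_one]
  · simp

theorem contDiff_legendre (r : ℕ) : ContDiff ℝ 1 (legendre r) := by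
  unfold legendre
  fun_prop

theorem continuous_legendre (r : ℕ) : Continuous (legendre r) := (contDiff_legendre r).continuous

theorem exists_abs_legendre_le (r : ℕ) : ∃ C, ∀ t ∈ Set.Icc (0 : ℝ) 1, |legendre r t| ≤ C :=
  isCompact_Icc.exists_bound_of_continuousOn (continuous_legendre r).continuousOn

theorem exists_abs_legendre_sub_le (r : ℕ) : ∃ K, 0 ≤ K ∧
    ∀ s ∈ Set.Icc (0 : ℝ) 1, ∀ t ∈ Set.Icc (0 : ℝ) 1,
      |legendre r s - legendre r t| ≤ K * |s - t| := by
  obtain ⟨K, hK⟩ := isCompact_Icc.exists_bound_of_continuousOn (s := Set.Icc (0 : ℝ) 1)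
    ((contDiff_legendre r).continuous_deriv le_rfl).continuousOn
  refine ⟨K, (norm_nonneg _).trans (hK 0 (by simp)), fun s hs t ht => ?_⟩
  exact (convex_Icc (0 : ℝ) 1).norm_image_sub_le_of_norm_deriv_le
    (fun x _ => (contDiff_legendre r).differentiable one_ne_zero x) hK ht hs

end Legendre

/-- The distribution function of the first coordinate. -/
noncomputable def firstCdf {d : ℕ} [NeZero d] (ν : Measure (Fin d → ℝ)) (x : ℝ) : ℝ :=
  (ν.map fun x => x 0).real (Set.Iic x)

/-! ### L-moments as expectations under `ν` -/

section Transport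

theorem ae_cube_mem_Icc {d : ℕ} [NeZero d] :
    ∀ᵐ u ∂volume.restrict (cube d), u 0 ∈ Set.Icc (0 : ℝ) 1 := by
  filter_upwards [ae_cube (0 : Fin d)] with u hu using ⟨hu.1.le, hu.2.le⟩

variable {d : ℕ} [NeZero d] {ν : Measure (Fin d → ℝ)}

/-- A map of the cube whose first coordinate is the first marginal quantile and which has the
right joint laws of the first coordinate with each other coordinate. -/
structure IsTransport (Q : (Fin d → ℝ) → Fin d → ℝ) (ν : Measure (Fin d → ℝ)) : Prop where
  measurable : Measurable Q
  map_pair : ∀ k, (volume.restrict (cube d)).map (fun u => (Q u 0, Q u k))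
    = ν.map fun x => (x 0, x k)
  zero : ∀ u, Q u 0 = quantile (ν.map fun x => x 0) (u 0)

variable {Q : (Fin d → ℝ) → Fin d → ℝ}

theorem IsTransport.integral_pair (hQ : IsTransport Q ν) (k : Fin d) {g : ℝ × ℝ → ℝ}
    (hg : Measurable g) :
    ∫ u in cube d, g (Q u 0, Q u k) = ∫ x, g (x 0, x k) ∂ν := by
  have hp : Measurable fun x : Fin d → ℝ => (x 0, x k) :=
    (measurable_pi_apply 0).prodMk (measurable_pi_apply k)
  rw [← integral_map (φ := fun u => (Q u 0, Q u k)) (f := g) (hp.comp hQ.measurable).aemeasurable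
    hg.aestronglyMeasurable, hQ.map_pair, integral_map hp.aemeasurable hg.aestronglyMeasurable]

theorem IsTransport.integrable_apply (hQ : IsTransport Q ν) (hint : Integrable (fun x => x) ν)
    (k : Fin d) : IntegrableOn (fun u => Q u k) (cube d) := by
  have hp : Measurable fun x : Fin d → ℝ => (x 0, x k) :=
    (measurable_pi_apply 0).prodMk (measurable_pi_apply k)
  have h : Integrable (Prod.snd : ℝ × ℝ → ℝ) (ν.map fun x => (x 0, x k)) :=
    (integrable_map_measure measurable_snd.aestronglyMeasurable hp.aemeasurable).2 (hint.eval k)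
  rw [← hQ.map_pair] at h
  exact (integrable_map_measure measurable_snd.aestronglyMeasurable
    (hp.comp hQ.measurable).aemeasurable).1 h

theorem IsTransport.integrable_mul (hQ : IsTransport Q ν) (hint : Integrable (fun x => x) ν)
    (k : Fin d) (r : ℕ) {s : (Fin d → ℝ) → ℝ} (hs : Measurable s)
    (hs01 : ∀ᵐ u ∂volume.restrict (cube d), s u ∈ Set.Icc (0 : ℝ) 1) :
    IntegrableOn (fun u => legendre r (s u) * Q u k) (cube d) := by
  obtain ⟨C, hC⟩ := exists_abs_legendre_le r
  refine (hQ.integrable_apply hint k).bdd_mul (c := C)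
    ((continuous_legendre r).measurable.comp hs).aestronglyMeasurable ?_
  filter_upwards [hs01] with u hu
  exact hC _ hu

theorem IsTransport.hasLMoment (hQ : IsTransport Q ν) (hint : Integrable (fun x => x) ν) (r : ℕ) :
    HasLMoment Q (firstIndex d r) := by
  refine Integrable.of_eval fun k => ?_
  simp only [legendreProd_firstIndex, Pi.smul_apply, smul_eq_mul]
  exact hQ.integrable_mul hint k r (measurable_pi_apply 0) ae_cube_mem_Icc

theorem IsTransport.lMoment_apply (hQ : IsTransport Q ν) (hint : Integrable (fun x => x) ν)
    (r : ℕ) (k : Fin d) :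
    lMoment Q (firstIndex d r) k = ∫ u in cube d, legendre r (u 0) * Q u k := by
  rw [lMoment, eval_integral (E := fun _ => ℝ) (hQ.hasLMoment hint r).eval]
  simp [legendreProd_firstIndex]

/-- An atom of the first marginal would charge a hyperplane, which is Lebesgue-null. -/
theorem nullSingletonClass_map_eval (hac : ν ≪ volume) :
    NullSingletonClass (ν.map fun x => x 0) := by
  refine ⟨fun a => ?_⟩
  rw [Measure.map_apply (measurable_pi_apply 0) (measurableSet_singleton a)]
  exact hac (Measure.pi_hyperplane (fun _ : Fin d => (volume : Measure ℝ)) 0 a)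

variable [IsProbabilityMeasure ν]

theorem measurable_firstCdf : Measurable (firstCdf ν) :=
  (monotone_real_Iic _).measurable

theorem firstCdf_mem_Icc (x : ℝ) : firstCdf ν x ∈ Set.Icc (0 : ℝ) 1 :=
  ⟨measureReal_nonneg, measureReal_le_one⟩

variable (ν) in
theorem isTransport_quantileGivenFirst : IsTransport (quantileGivenFirst ν) ν :=
  ⟨measurable_quantileGivenFirst ν, map_pair_quantileGivenFirst ν, quantileGivenFirst_zero ν⟩

variable (ν) in
theorem isTransport_rosenblattQuantile : IsTransport (rosenblattQuantile ν) ν := by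
  refine ⟨measurable_rosenblattQuantile ν, fun k => ?_, rosenblattQuantile_zero ν⟩
  have hp : Measurable fun x : Fin d → ℝ => (x 0, x k) :=
    (measurable_pi_apply 0).prodMk (measurable_pi_apply k)
  conv_rhs => rw [← map_rosenblattQuantile ν]
  rw [Measure.map_map hp (measurable_rosenblattQuantile ν)]
  rfl

/-- When the atoms of the first marginal are small, the L-moment is close to
`E[L_r(F(X₀)) X]`. -/
theorem IsTransport.abs_lMoment_sub_le (hQ : IsTransport Q ν) (hint : Integrable (fun x => x) ν)
    {r : ℕ} {K : ℝ} (hK : 0 ≤ K)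
    (hlip : ∀ s ∈ Set.Icc (0 : ℝ) 1, ∀ t ∈ Set.Icc (0 : ℝ) 1,
      |legendre r s - legendre r t| ≤ K * |s - t|)
    {δ : ℝ} (hδ : ∀ a, (ν.map fun x => x 0).real {a} ≤ δ) (k : Fin d) :
    |lMoment Q (firstIndex d r) k - ∫ x, legendre r (firstCdf ν (x 0)) * x k ∂ν|
      ≤ K * δ * ∫ x, |x k| ∂ν := by
  have hQ0 : Measurable fun u => Q u 0 := (measurable_pi_apply 0).comp hQ.measurable
  have hF : Measurable fun u => firstCdf ν (Q u 0) := measurable_firstCdf.comp hQ0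
  have h1 := hQ.integrable_mul hint k r (measurable_pi_apply 0) ae_cube_mem_Icc
  have h2 := hQ.integrable_mul hint k r hF (Eventually.of_forall fun u => firstCdf_mem_Icc _)
  have hg : Measurable fun p : ℝ × ℝ => legendre r (firstCdf ν p.1) * p.2 :=
    ((continuous_legendre r).measurable.comp (measurable_firstCdf.comp measurable_fst)).mul
      measurable_snd
  have habs : Measurable fun p : ℝ × ℝ => |p.2| := measurable_snd.abs
  rw [hQ.lMoment_apply hint, ← hQ.integral_pair k hg, ← integral_sub h1 h2,
    ← hQ.integral_pair k habs, ← integral_const_mul]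
  rw [← Real.norm_eq_abs]
  refine norm_integral_le_of_norm_le ((hQ.integrable_apply hint k).abs.const_mul _) ?_
  filter_upwards [ae_cube (0 : Fin d)] with u hu
  -- The distribution function at the quantile overshoots the level by at most the atom there,
  -- whence `u 0 ≤ F (Q u 0) ≤ u 0 + δ`.
  have hq0 : u 0 ≤ firstCdf ν (Q u 0) := by
    rw [hQ.zero, firstCdf]
    exact le_real_Iic_quantile hu.1 hu.2
  have hq1 : firstCdf ν (Q u 0) ≤ u 0 + δ := by
    rw [hQ.zero, firstCdf]
    exact (real_Iic_quantile_le hu.1 hu.2).trans (by gcongr; exact hδ _)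
  rw [← sub_mul, Real.norm_eq_abs, abs_mul]
  gcongr
  refine (hlip _ ⟨hu.1.le, hu.2.le⟩ _ (firstCdf_mem_Icc _)).trans ?_
  gcongr
  rw [abs_le]
  constructor <;> linarith

theorem integrable_legendre_firstCdf_smul (hint : Integrable (fun x => x) ν) (r : ℕ) :
    Integrable (fun x => legendre r (firstCdf ν (x 0)) • x) ν := by
  obtain ⟨C, hC⟩ := exists_abs_legendre_le r
  have hm : Measurable fun x : Fin d → ℝ => legendre r (firstCdf ν (x 0)) :=
    (continuous_legendre r).measurable.comp (measurable_firstCdf.comp (measurable_pi_apply 0))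
  refine Integrable.of_eval fun k => ?_
  exact (hint.eval k).bdd_mul hm.aestronglyMeasurable
    (Eventually.of_forall fun x => hC _ (firstCdf_mem_Icc _))

theorem IsTransport.lMoment_eq [NullSingletonClass (ν.map fun x => x 0)] (hQ : IsTransport Q ν)
    (hint : Integrable (fun x => x) ν) (r : ℕ) :
    lMoment Q (firstIndex d r) = ∫ x, legendre r (firstCdf ν (x 0)) • x ∂ν := by
  obtain ⟨K, hK, hlip⟩ := exists_abs_legendre_sub_le r
  funext k
  rw [eval_integral (E := fun _ => ℝ) (integrable_legendre_firstCdf_smul hint r).eval]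
  have h := hQ.abs_lMoment_sub_le hint hK hlip (δ := 0) (fun a => by simp [measureReal_def]) k
  rw [mul_zero, zero_mul] at h
  simpa using sub_eq_zero.1 (abs_eq_zero.1 (le_antisymm h (abs_nonneg _)))

end Transport

/-! ### Unbiased weights against Legendre values -/

section Weights

open Polynomial in
-- Leibniz's rule applied to Rodrigues' formula, the `m`-th derivative of `X ^ m * (1 - X) ^ m`; the
-- falling factorials combine into `m! * (m.choose k) ^ 2`.
theorem shiftedLegendre_eq_sum (m : ℕ) :
    shiftedLegendre m = ∑ k ∈ Finset.range (m + 1),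
      (-1 : ℤ[X]) ^ k * (m.choose k : ℤ[X]) ^ 2 * X ^ k * (1 - X) ^ (m - k) := by
  have hf : (m.factorial : ℤ[X]) ≠ 0 := by exact_mod_cast m.factorial_ne_zero
  refine mul_left_cancel₀ hf ?_
  rw [factorial_mul_shiftedLegendre_eq, iterate_derivative_mul, Finset.mul_sum]
  refine Finset.sum_congr rfl fun k hk => ?_
  have hkm : k ≤ m := Nat.lt_succ_iff.1 (Finset.mem_range.1 hk)
  have h1 : derivative^[k] ((1 - X : ℤ[X]) ^ m)
      = (-1) ^ k * ((m.descFactorial k : ℤ[X]) * (1 - X) ^ (m - k)) := by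
    have := iterate_derivative_comp_one_sub_X (X ^ m : ℤ[X]) k
    rw [iterate_derivative_X_pow_eq_natCast_mul] at this
    simpa using this
  have h2 : (m.choose k : ℤ[X]) * (m.descFactorial (m - k) * m.descFactorial k)
      = m.factorial * m.choose k ^ 2 := by
    have : m.descFactorial (m - k) * m.descFactorial k = m.factorial * m.choose k := by
      rw [Nat.descFactorial_eq_factorial_mul_choose m k, ← mul_assoc, mul_comm (m.descFactorial _)]
      congr 1
      simpa [Nat.sub_sub_self hkm] using Nat.factorial_mul_descFactorial (Nat.sub_le m k)
    exact_mod_cast (by rw [this]; ring :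
      m.choose k * (m.descFactorial (m - k) * m.descFactorial k) = m.factorial * m.choose k ^ 2)
  rw [h1, iterate_derivative_X_pow_eq_natCast_mul, Nat.sub_sub_self hkm, nsmul_eq_mul]
  linear_combination (-1 : ℤ[X]) ^ k * X ^ k * (1 - X) ^ (m - k) * h2

/-- The monomial form carries the same coefficients as `unbiasedWeight`, with `t ^ j` in place of
the binomial ratio. It comes from the value at `1 - t` and the symmetry of the shifted Legendre
polynomial. -/
theorem legendre_succ_eq_sum (m : ℕ) (t : ℝ) :
    legendre (m + 1) t = ∑ j ∈ Finset.range (m + 1),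
      (-1 : ℝ) ^ (m - j) * (m.choose j : ℝ) * ((m + j).choose j : ℝ) * t ^ j := by
  have h1 : legendre (m + 1) t = Polynomial.aeval (1 - t) (Polynomial.shiftedLegendre m) := by
    rw [shiftedLegendre_eq_sum, legendre]
    simp only [map_sum, map_mul, map_pow, map_neg, map_one, map_natCast, Polynomial.aeval_X,
      map_sub, Nat.add_sub_cancel]
    refine Finset.sum_congr rfl fun k _ => ?_
    rw [sub_sub_cancel]
    ring
  have h2 := Polynomial.shiftedLegendre_eval_symm m (1 - t)
  rw [sub_sub_cancel] at h2
  rw [h1, h2, Polynomial.shiftedLegendre]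
  simp only [map_sum, map_mul, map_pow, Polynomial.aeval_X, Polynomial.aeval_C, Finset.mul_sum]
  refine Finset.sum_congr rfl fun k hk => ?_
  have hkm : k ≤ m := Nat.lt_succ_iff.1 (Finset.mem_range.1 hk)
  have hs : (-1 : ℝ) ^ m * (-1) ^ k = (-1) ^ (m - k) := by
    obtain ⟨l, rfl⟩ := Nat.exists_eq_add_of_le hkm
    rw [Nat.add_sub_cancel_left, pow_add, mul_right_comm, ← mul_pow]
    simp
  rw [← hs, Nat.choose_symm_add.symm]
  simp
  ring

/-- The ratio is the product of the factors `(i - l) / (N - l)` for `l < j` (truncated subtraction),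
each within `(l + 1) / (N + 1)` of `(i + 1) / (N + 1)`. The errors add up because everything stays
in `[0, 1]`, and `j ^ 2 + (j + 1) ≤ (j + 1) ^ 2` closes the induction. -/
theorem abs_choose_ratio_sub_le (j : ℕ) : ∀ N i : ℕ, j ≤ N → i ≤ N →
    |((N.choose j : ℝ))⁻¹ * (i.choose j : ℝ) - (((i : ℝ) + 1) / (N + 1)) ^ j|
      ≤ (j : ℝ) ^ 2 / (N + 1) := by
  induction j with
  | zero => intro N i _ _; simp
  | succ j ih =>
    intro N i hjN hiN
    have hN : (0 : ℝ) < N + 1 := by positivity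
    have hNj : (0 : ℝ) < ((N - j : ℕ) : ℝ) := by exact_mod_cast Nat.sub_pos_of_lt hjN
    have hc : (0 : ℝ) < N.choose j := by exact_mod_cast Nat.choose_pos (by omega)
    have hiN' : (i : ℝ) ≤ N := by exact_mod_cast hiN
    set a : ℝ := (N.choose j : ℝ)⁻¹ * (i.choose j : ℝ) with ha
    set b : ℝ := ((i - j : ℕ) : ℝ) / ((N - j : ℕ) : ℝ)
    set p : ℝ := ((i : ℝ) + 1) / (N + 1)
    have ha0 : 0 ≤ a := by positivity
    have ha1 : a ≤ 1 := by
      rw [inv_mul_le_one₀ hc]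
      exact_mod_cast Nat.choose_le_choose j hiN
    have hp0 : 0 ≤ p := by positivity
    have hp1 : p ≤ 1 := by rw [div_le_one hN]; linarith
    have hstep : (N.choose (j + 1) : ℝ)⁻¹ * (i.choose (j + 1) : ℝ) = a * b := by
      have h1 : (N.choose (j + 1) : ℝ) * (j + 1) = N.choose j * ((N - j : ℕ) : ℝ) := by
        exact_mod_cast Nat.choose_succ_right_eq N j
      have h2 : (i.choose (j + 1) : ℝ) * (j + 1) = i.choose j * ((i - j : ℕ) : ℝ) := by
        exact_mod_cast Nat.choose_succ_right_eq i j
      have hj : (0 : ℝ) < (j : ℝ) + 1 := by positivity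
      rw [← eq_div_iff hj.ne'] at h1 h2
      rw [h1, h2]
      simp only [a, b]
      field_simp
    have hb : |b - p| ≤ (j + 1) / (N + 1) := by
      simp only [b, p]
      rcases lt_or_ge i j with hij | hij
      · rw [Nat.sub_eq_zero_of_le hij.le, Nat.cast_zero, zero_div, zero_sub, abs_neg,
          abs_of_nonneg hp0]
        have : (i : ℝ) ≤ j := by exact_mod_cast hij.le
        exact div_le_div_of_nonneg_right (by linarith) hN.le
      · have hji : (j : ℝ) ≤ i := by exact_mod_cast hij
        rw [Nat.cast_sub (by omega : j ≤ N)] at hNj ⊢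
        rw [Nat.cast_sub hij]
        have he : ((i : ℝ) - j) / (N - j) - (i + 1) / (N + 1)
            = -((j + 1) / (N + 1) * ((N - i) / (N - j))) := by
          field_simp
          ring
        have hle : ((N : ℝ) - i) / (N - j) ≤ 1 := by
          rw [div_le_one hNj]
          linarith
        have h0 : 0 ≤ ((N : ℝ) - i) / (N - j) := div_nonneg (by linarith) hNj.le
        rw [he, abs_neg, abs_of_nonneg (by positivity)]
        exact mul_le_of_le_one_right (by positivity) hle
    rw [hstep, pow_succ]
    clear_value a
    have hsplit : a * b - p ^ j * p = a * (b - p) + (a - p ^ j) * p := by ring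
    have hih : |a - p ^ j| ≤ (j : ℝ) ^ 2 / (N + 1) := by
      rw [ha]
      exact ih N i (by omega) hiN
    rw [hsplit]
    refine (abs_add_le _ _).trans ?_
    rw [abs_mul, abs_mul, abs_of_nonneg ha0, abs_of_nonneg hp0]
    calc a * |b - p| + |a - p ^ j| * p ≤ 1 * ((j + 1) / (N + 1)) + (j : ℝ) ^ 2 / (N + 1) * 1 := by
          gcongr
      _ ≤ ((j + 1 : ℕ) : ℝ) ^ 2 / (N + 1) := by
          rw [one_mul, mul_one, ← add_div]
          gcongr
          push_cast
          nlinarith [(Nat.cast_nonneg j : (0 : ℝ) ≤ j)]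

/-- The cutoff at `i` may be dropped, since `i.choose j = 0` for `j > i`. -/
theorem unbiasedWeight_eq (m n i : ℕ) :
    unbiasedWeight (m + 1) n i = ∑ j ∈ Finset.range (m + 1),
      (-1 : ℝ) ^ (m - j) * (m.choose j : ℝ) * ((m + j).choose j : ℝ)
        * (((n - 1).choose j : ℝ)⁻¹ * (i.choose j : ℝ)) := by
  rw [unbiasedWeight]
  simp only [Nat.add_sub_cancel, mul_assoc]
  refine Finset.sum_subset (Finset.range_subset_range.2 (by omega)) fun j hj hj' => ?_
  rw [Finset.mem_range] at hj hj'
  rw [Nat.choose_eq_zero_of_lt (show i < j by omega)]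
  simp

theorem eventually_abs_unbiasedWeight_sub_le {r : ℕ} (hr : 1 ≤ r) {ε : ℝ} (hε : 0 < ε) :
    ∀ᶠ n : ℕ in atTop, ∀ i < n, |unbiasedWeight r n i - legendre r (((i : ℝ) + 1) / n)| ≤ ε := by
  obtain ⟨m, rfl⟩ := Nat.exists_eq_add_of_le' hr
  set C : ℝ := ∑ j ∈ Finset.range (m + 1), (m.choose j : ℝ) * ((m + j).choose j : ℝ) * (j : ℝ) ^ 2
  have hlim : Tendsto (fun n : ℕ => C / (n : ℝ)) atTop (𝓝 0) :=
    tendsto_const_div_atTop_nhds_zero_nat C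
  filter_upwards [hlim.eventually (ge_mem_nhds hε), eventually_gt_atTop m] with n hn hmn i hi
  obtain ⟨N, rfl⟩ := Nat.exists_eq_add_of_le' (show 1 ≤ n by omega)
  refine le_trans ?_ hn
  rw [unbiasedWeight_eq, legendre_succ_eq_sum, ← Finset.sum_sub_distrib, Finset.sum_div]
  refine (Finset.abs_sum_le_sum_abs _ _).trans (Finset.sum_le_sum fun j hj => ?_)
  have h := abs_choose_ratio_sub_le j N i (by rw [Finset.mem_range] at hj; omega) (by omega)
  rw [← mul_sub, abs_mul, abs_mul, abs_mul, abs_pow, abs_neg, abs_one, one_pow, one_mul,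
    Nat.abs_cast, Nat.abs_cast, mul_div_assoc]
  gcongr
  simpa using h

end Weights

/-! ### Empirical measures -/

section Empirical

variable {d n : ℕ}

theorem isProbabilityMeasure_empiricalMeasure (hn : n ≠ 0) (x : Fin n → Fin d → ℝ) :
    IsProbabilityMeasure (empiricalMeasure x) := by
  have h0 : (n : ℝ≥0∞) ≠ 0 := by exact_mod_cast hn
  exact ⟨by simp [empiricalMeasure, ENNReal.inv_mul_cancel h0 (ENNReal.natCast_ne_top n)]⟩

theorem integrable_empiricalMeasure {E : Type*} [NormedAddCommGroup E] (x : Fin n → Fin d → ℝ)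
    (hn : n ≠ 0) (f : (Fin d → ℝ) → E) : Integrable f (empiricalMeasure x) := by
  refine Integrable.smul_measure ?_ (by simpa using hn)
  exact integrable_finsetSum_measure.2 fun i _ => integrable_dirac (by simp)

theorem integral_empiricalMeasure {E : Type*} [NormedAddCommGroup E] [NormedSpace ℝ E]
    [CompleteSpace E] (x : Fin n → Fin d → ℝ) (f : (Fin d → ℝ) → E) :
    ∫ y, f y ∂empiricalMeasure x = (n : ℝ)⁻¹ • ∑ i, f (x i) := by
  rw [empiricalMeasure, integral_smul_measure,
    integral_finsetSum_measure fun i _ => integrable_dirac (by simp)]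
  simp

theorem map_real_empiricalMeasure (x : Fin n → Fin d → ℝ) {k : Fin d} {s : Set ℝ}
    (hs : MeasurableSet s) :
    ((empiricalMeasure x).map fun y => y k).real s
      = (n : ℝ)⁻¹ * ∑ i, s.indicator 1 (x i k) := by
  rw [map_measureReal_apply (measurable_pi_apply k) hs,
    ← integral_indicator_one (measurable_pi_apply k hs), integral_empiricalMeasure]
  rfl

theorem map_real_singleton_empiricalMeasure_le {x : Fin n → Fin d → ℝ} {k : Fin d}
    (hx : Function.Injective fun i => x i k) (a : ℝ) :
    ((empiricalMeasure x).map fun y => y k).real {a} ≤ (n : ℝ)⁻¹ := by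
  classical
  rw [map_real_empiricalMeasure x (measurableSet_singleton a)]
  refine mul_le_of_le_one_right (by positivity) ?_
  simp only [Set.indicator_apply, Set.mem_singleton_iff, Pi.one_apply, Finset.sum_boole]
  exact_mod_cast Finset.card_le_one.2 fun i hi j hj => hx (by simp_all)

variable [NeZero d]

/-- Without ties, exactly the positions `0, …, i` hold first coordinates not exceeding that at
position `i`. -/
theorem firstCdf_empiricalMeasure_sortedByFirst {x : Fin n → Fin d → ℝ}
    (hx : Function.Injective fun i => x i 0) (i : Fin n) :
    firstCdf (empiricalMeasure x) (sortedByFirst x i 0) = ((i : ℝ) + 1) / n := by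
  classical
  have hmono : StrictMono fun i => sortedByFirst x i 0 :=
    (Tuple.monotone_sort fun l => x l 0).strictMono_of_injective
      (hx.comp (Tuple.sort fun l => x l 0).injective)
  rw [firstCdf, map_real_empiricalMeasure x measurableSet_Iic,
    ← Equiv.sum_comp (Tuple.sort fun l => x l 0)]
  have h : ∀ l, (Set.Iic (sortedByFirst x i 0)).indicator (1 : ℝ → ℝ)
      (x (Tuple.sort (fun l => x l 0) l) 0) = if l ≤ i then 1 else 0 := fun l => by
    rw [Set.indicator_apply]
    exact if_congr hmono.le_iff_le rfl rfl
  simp_rw [h, Finset.sum_boole]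
  have hc : (Finset.univ.filter fun l => l ≤ i) = Finset.Iic i := by ext; simp
  rw [hc, Fin.card_Iic]
  push_cast
  rw [mul_comm, div_eq_mul_inv]

end Empirical

/-! ### Glivenko–Cantelli -/

section GlivenkoCantelli

/-- Uniform convergence of distribution functions follows from convergence at the quantiles of
rational levels, when the limit has no atoms. -/
theorem eventually_abs_real_Iic_sub_le {μ : Measure ℝ} [IsProbabilityMeasure μ]
    [NullSingletonClass μ] {F : ℕ → ℝ → ℝ} (hmono : ∀ n, Monotone (F n))
    (h0 : ∀ n x, 0 ≤ F n x) (h1 : ∀ n x, F n x ≤ 1)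
    (hF : ∀ m j : ℕ, Tendsto (fun n => F n (quantile μ ((j : ℝ) / m))) atTop
      (𝓝 (μ.real (Set.Iic (quantile μ ((j : ℝ) / m)))))) {ε : ℝ} (hε : 0 < ε) :
    ∀ᶠ n in atTop, ∀ x, |F n x - μ.real (Set.Iic x)| ≤ ε := by
  -- One `1/m` pays for the grid spacing, another for the error at the grid points.
  obtain ⟨m, hm⟩ := exists_nat_gt (2 / ε)
  have hm0 : (0 : ℝ) < m := (by positivity : 0 < 2 / ε).trans hm
  have hmε : 2 / (m : ℝ) ≤ ε := by
    rw [div_le_iff₀ hm0]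
    rw [div_lt_iff₀ hε] at hm
    linarith
  have hev : ∀ᶠ n in atTop, ∀ j ∈ Finset.range m,
      |F n (quantile μ ((j : ℝ) / m)) - μ.real (Set.Iic (quantile μ ((j : ℝ) / m)))| < 1 / m := by
    rw [Filter.eventually_all_finset]
    exact fun j _ => Metric.tendsto_nhds.1 (hF m j) _ (by positivity)
  filter_upwards [hev] with n hn x
  refine le_trans ?_ hmε
  set p := μ.real (Set.Iic x) with hp
  have hp0 : 0 ≤ p := measureReal_nonneg
  have hp1 : p ≤ 1 := measureReal_le_one
  -- Only interior levels are usable: at levels `0` and `1` the quantile need not invert the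
  -- distribution function, and the bounds `0 ≤ F n x ≤ 1` take over.
  have hlevel : ∀ j : ℕ, 0 < j → j < m →
      |F n (quantile μ ((j : ℝ) / m)) - (j : ℝ) / m| < 1 / m ∧
        (quantile μ ((j : ℝ) / m) ≤ x ↔ (j : ℝ) / m ≤ p) := fun j hj hjm => by
    have ht0 : 0 < (j : ℝ) / m := div_pos (by exact_mod_cast hj) hm0
    have ht1 : (j : ℝ) / m < 1 := by rw [div_lt_one hm0]; exact_mod_cast hjm
    have h := hn j (Finset.mem_range.2 hjm)
    rw [real_Iic_quantile ht0 ht1] at h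
    exact ⟨h, quantile_le_iff ht0 ht1⟩
  set j := ⌊p * m⌋₊ with hj
  have hj1 : (j : ℝ) / m ≤ p := by
    rw [div_le_iff₀ hm0]
    exact Nat.floor_le (by positivity)
  have hj2 : p < ((j + 1 : ℕ) : ℝ) / m := by
    rw [lt_div_iff₀ hm0]
    push_cast
    exact Nat.lt_floor_add_one _
  have hsplit : ((j + 1 : ℕ) : ℝ) / m = (j : ℝ) / m + 1 / m := by push_cast; ring
  have htwo : 2 / (m : ℝ) = 1 / m + 1 / m := by ring
  have hm1 : 0 < 1 / (m : ℝ) := by positivity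
  rw [abs_le]
  constructor
  · obtain ⟨k, hkm, hk1, hk2⟩ : ∃ k < m, (k : ℝ) / m ≤ p ∧ p ≤ (k : ℝ) / m + 1 / m := by
      by_cases hjm : j < m
      · exact ⟨j, hjm, hj1, by linarith⟩
      · have hm1' : 0 < m := by exact_mod_cast hm0
        have hjm' : ((m - 1 : ℕ) : ℝ) ≤ j := by exact_mod_cast (by omega : m - 1 ≤ j)
        -- When `p = 1` the floor is `m`; the last interior level still lies within `1/m` of `p`.
        refine ⟨m - 1, by omega, (div_le_div_of_nonneg_right hjm' hm0.le).trans hj1, ?_⟩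
        rw [← add_div, Nat.cast_sub hm1', Nat.cast_one, sub_add_cancel, div_self hm0.ne']
        exact hp1
    rcases Nat.eq_zero_or_pos k with hz | hpos
    · rw [hz, Nat.cast_zero, zero_div] at hk2
      linarith [h0 n x]
    · obtain ⟨ha, hb⟩ := hlevel k hpos hkm
      have hc := hmono n (hb.2 hk1)
      have hd := (abs_lt.1 ha).1
      linarith
  · by_cases hjm : j + 1 < m
    · obtain ⟨ha, hb⟩ := hlevel (j + 1) (Nat.succ_pos _) hjm
      have hc := hmono n (le_of_lt (not_le.1 fun h => absurd (hb.1 h) (not_le.2 hj2)))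
      have hd := (abs_lt.1 ha).2
      linarith
    · have hge : (1 : ℝ) ≤ ((j + 1 : ℕ) : ℝ) / m := by
        rw [le_div_iff₀ hm0, one_mul]
        exact_mod_cast not_lt.1 hjm
      linarith [h1 n x]

end GlivenkoCantelli

/-! ### Convergence along a typical sample path -/

section Deterministic

/-- Perturbing the weights of an average uniformly by `o(1)` does not change its limit when the
averages of the norms are bounded. -/
theorem tendsto_average_of_weights {E : Type*} [NormedAddCommGroup E] [NormedSpace ℝ E]
    {x : ℕ → E} {M : ℝ} {L : E} {a b : ∀ n : ℕ, Fin n → ℝ}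
    (hM : Tendsto (fun n : ℕ => (n : ℝ)⁻¹ * ∑ i : Fin n, ‖x i‖) atTop (𝓝 M))
    (hb : Tendsto (fun n : ℕ => (n : ℝ)⁻¹ • ∑ i : Fin n, b n i • x i) atTop (𝓝 L))
    (hab : ∀ ε > 0, ∀ᶠ n in atTop, ∀ i, |a n i - b n i| ≤ ε) :
    Tendsto (fun n : ℕ => (n : ℝ)⁻¹ • ∑ i : Fin n, a n i • x i) atTop (𝓝 L) := by
  have hdiff : Tendsto (fun n : ℕ => (n : ℝ)⁻¹ • ∑ i : Fin n, (a n i - b n i) • x i) atTop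
      (𝓝 0) := by
    rw [NormedAddGroup.tendsto_nhds_zero]
    intro ε hε
    have hM0 : 0 ≤ M := ge_of_tendsto' hM fun n => by positivity
    have hM1 : (0 : ℝ) < M + 1 := by linarith
    filter_upwards [hM.eventually (gt_mem_nhds (lt_add_one M)),
      hab (ε / 2 / (M + 1)) (by positivity)] with n hn hi
    calc ‖(n : ℝ)⁻¹ • ∑ i : Fin n, (a n i - b n i) • x i‖
        ≤ (n : ℝ)⁻¹ * ∑ i : Fin n, ε / 2 / (M + 1) * ‖x i‖ := by
          rw [norm_smul, norm_inv, Real.norm_natCast]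
          gcongr
          refine (norm_sum_le _ _).trans (Finset.sum_le_sum fun i _ => ?_)
          rw [norm_smul]
          gcongr
          exact hi i
      _ = ε / 2 / (M + 1) * ((n : ℝ)⁻¹ * ∑ i : Fin n, ‖x i‖) := by
          rw [← Finset.mul_sum]
          ring
      _ ≤ ε / 2 / (M + 1) * (M + 1) := by gcongr
      _ = ε / 2 := by field_simp
      _ < ε := by linarith
  have h := hdiff.add hb
  rw [zero_add] at h
  refine h.congr fun n => ?_
  rw [← smul_add, ← Finset.sum_add_distrib]
  simp [sub_smul]

variable {d : ℕ} [NeZero d]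

/-- Summing over sample points instead of positions attaches to each point the weight of its rank,
so the weights can be compared with `L_r(F_n(x_i 0))`. -/
theorem unbiasedLMoment_eq {n : ℕ} (x : Fin n → Fin d → ℝ) (r : ℕ) :
    unbiasedLMoment x r = (n : ℝ)⁻¹ • ∑ i,
      unbiasedWeight r n ((Tuple.sort fun l => x l 0).symm i) • x i := by
  conv_rhs => rw [← Equiv.sum_comp (Tuple.sort fun l => x l 0)]
  rw [unbiasedLMoment]
  simp [sortedByFirst]

/-- A sample path along which the estimators converge. -/
structure IsTypical (ν : Measure (Fin d → ℝ)) (r : ℕ) (x : ℕ → Fin d → ℝ) : Prop where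
  injective : Function.Injective fun i => x i 0
  norm : Tendsto (fun n : ℕ => (n : ℝ)⁻¹ * ∑ i : Fin n, ‖x i‖) atTop (𝓝 (∫ y, ‖y‖ ∂ν))
  moment : Tendsto
    (fun n : ℕ => (n : ℝ)⁻¹ • ∑ i : Fin n, legendre r (firstCdf ν (x i 0)) • x i) atTop
    (𝓝 (∫ y, legendre r (firstCdf ν (y 0)) • y ∂ν))
  cdf : ∀ m j : ℕ, Tendsto (fun n : ℕ => firstCdf (empiricalMeasure fun i : Fin n => x i)
      (quantile (ν.map fun y => y 0) ((j : ℝ) / m))) atTop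
    (𝓝 (firstCdf ν (quantile (ν.map fun y => y 0) ((j : ℝ) / m))))

namespace IsTypical

variable {ν : Measure (Fin d → ℝ)} {r : ℕ} {x : ℕ → Fin d → ℝ}

theorem injective_fin (hx : IsTypical ν r x) (n : ℕ) :
    Function.Injective fun i : Fin n => x i 0 := fun _ _ h => Fin.ext (hx.injective h)

variable [IsProbabilityMeasure ν] [NullSingletonClass (ν.map fun x => x 0)]

theorem eventually_abs_firstCdf_sub_le (hx : IsTypical ν r x) {ε : ℝ} (hε : 0 < ε) :
    ∀ᶠ n : ℕ in atTop, ∀ a,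
      |firstCdf (empiricalMeasure fun i : Fin n => x i) a - firstCdf ν a| ≤ ε := by
  have h := eventually_abs_real_Iic_sub_le (μ := ν.map fun y => y 0)
    -- The shift to `n + 1` excludes the empty sample, whose empirical measure is zero.
    (F := fun n => firstCdf (empiricalMeasure fun i : Fin (n + 1) => x i))
    (fun n => ?_) (fun n a => measureReal_nonneg) (fun n a => ?_)
    (fun m j => (tendsto_add_atTop_iff_nat 1).2 (hx.cdf m j)) hε
  · rw [← map_add_atTop_eq_nat 1, eventually_map]
    exact h
  · have := isProbabilityMeasure_empiricalMeasure n.succ_ne_zero fun i : Fin (n + 1) => x i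
    exact monotone_real_Iic _
  · have := isProbabilityMeasure_empiricalMeasure n.succ_ne_zero fun i : Fin (n + 1) => x i
    exact (firstCdf_mem_Icc a).2

theorem tendsto_empirical_moment (hx : IsTypical ν r x) :
    Tendsto (fun n : ℕ => (n : ℝ)⁻¹ • ∑ i : Fin n,
      legendre r (firstCdf (empiricalMeasure fun i : Fin n => x i) (x i 0)) • x i) atTop
      (𝓝 (∫ y, legendre r (firstCdf ν (y 0)) • y ∂ν)) := by
  obtain ⟨K, hK, hlip⟩ := exists_abs_legendre_sub_le r
  refine tendsto_average_of_weights hx.norm hx.moment fun ε hε => ?_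
  have hK1 : 0 < K + 1 := by linarith
  filter_upwards [hx.eventually_abs_firstCdf_sub_le (show 0 < ε / (K + 1) by positivity),
    eventually_ne_atTop 0] with n hn hn0 i
  have := isProbabilityMeasure_empiricalMeasure hn0 fun i : Fin n => x i
  calc _ ≤ K * _ := hlip _ (firstCdf_mem_Icc _) _ (firstCdf_mem_Icc _)
    _ ≤ (K + 1) * (ε / (K + 1)) := by
      gcongr
      · linarith
      · exact hn _
    _ = ε := by field_simp

theorem tendsto_unbiasedLMoment (hx : IsTypical ν r x) (hr : 1 ≤ r) :
    Tendsto (fun n : ℕ => unbiasedLMoment (fun i : Fin n => x i) r) atTop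
      (𝓝 (∫ y, legendre r (firstCdf ν (y 0)) • y ∂ν)) := by
  simp_rw [unbiasedLMoment_eq]
  refine tendsto_average_of_weights hx.norm hx.tendsto_empirical_moment fun ε hε => ?_
  filter_upwards [eventually_abs_unbiasedWeight_sub_le hr hε] with n hn i
  have h := firstCdf_empiricalMeasure_sortedByFirst (hx.injective_fin n)
    ((Tuple.sort fun l : Fin n => x l 0).symm i)
  rw [sortedByFirst, Equiv.apply_symm_apply] at h
  rw [h]
  exact hn _ (Fin.is_lt _)

/-- The transport estimate with atoms of mass at most `1/n` bounds the distance to the empirical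
moment by `K/n` times the mean norm, which tends to `0`. -/
theorem tendsto_plugInLMoment (hx : IsTypical ν r x) :
    Tendsto (fun n : ℕ => plugInLMoment (fun i : Fin n => x i) (firstIndex d r)) atTop
      (𝓝 (∫ y, legendre r (firstCdf ν (y 0)) • y ∂ν)) := by
  obtain ⟨K, hK, hlip⟩ := exists_abs_legendre_sub_le r
  rw [tendsto_pi_nhds]
  intro k
  have hlim := (tendsto_pi_nhds.1 hx.tendsto_empirical_moment) k
  have hbound : Tendsto (fun n : ℕ => K * (n : ℝ)⁻¹ * ((n : ℝ)⁻¹ * ∑ i : Fin n, ‖x i‖)) atTop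
      (𝓝 0) := by
    have h := (tendsto_inv_atTop_nhds_zero_nat (𝕜 := ℝ)).const_mul K |>.mul hx.norm
    simpa using h
  refine tendsto_of_tendsto_of_dist hlim (squeeze_zero' (Eventually.of_forall fun n => dist_nonneg)
    ?_ hbound)
  filter_upwards [eventually_ne_atTop 0] with n hn0
  have := isProbabilityMeasure_empiricalMeasure hn0 fun i : Fin n => x i
  have h := (isTransport_rosenblattQuantile (empiricalMeasure fun i : Fin n => x i)).abs_lMoment_sub_le
    (integrable_empiricalMeasure _ hn0 _) hK hlip
    (map_real_singleton_empiricalMeasure_le (hx.injective_fin n)) k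
  rw [integral_empiricalMeasure, integral_empiricalMeasure] at h
  rw [dist_comm, Real.dist_eq, plugInLMoment]
  have h2 : (n : ℝ)⁻¹ • ∑ i : Fin n, |x i k| ≤ (n : ℝ)⁻¹ * ∑ i : Fin n, ‖x i‖ := by
    rw [smul_eq_mul]
    gcongr with i
    exact norm_le_pi_norm (x i) k
  refine le_trans (le_of_eq ?_) (h.trans (by gcongr))
  simp

end IsTypical

end Deterministic

/-! ### Almost every sample path is typical -/

section Probabilistic

variable {d : ℕ} {Ω : Type*} [MeasurableSpace Ω] {P : Measure Ω} {ν : Measure (Fin d → ℝ)}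
  {X : ℕ → Ω → Fin d → ℝ}

theorem ae_tendsto_average {E : Type*} [NormedAddCommGroup E] [NormedSpace ℝ E] [CompleteSpace E]
    [MeasurableSpace E] [BorelSpace E] (hX : ∀ i, Measurable (X i)) (hlaw : ∀ i, P.map (X i) = ν)
    (hindep : iIndepFun X P) {g : (Fin d → ℝ) → E} (hg : Measurable g) (hgi : Integrable g ν) :
    ∀ᵐ ω ∂P, Tendsto (fun n : ℕ => (n : ℝ)⁻¹ • ∑ i : Fin n, g (X i ω)) atTop
      (𝓝 (∫ y, g y ∂ν)) := by
  have hid : ∀ i, IdentDistrib (fun ω => g (X i ω)) (fun ω => g (X 0 ω)) P P := fun i =>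
    (IdentDistrib.mk (hX i).aemeasurable (hX 0).aemeasurable ((hlaw i).trans (hlaw 0).symm)).comp hg
  have hint : Integrable (fun ω => g (X 0 ω)) P := by
    rw [← hlaw 0] at hgi
    exact hgi.comp_measurable (hX 0)
  have h := strong_law_ae (fun i ω => g (X i ω)) hint
    (fun i j hij => (hindep.indepFun hij).comp hg hg) hid
  have he : ∫ ω, g (X 0 ω) ∂P = ∫ y, g y ∂ν := by
    rw [← hlaw 0] at hgi ⊢
    rw [integral_map (hX 0).aemeasurable hgi.aestronglyMeasurable]
  rw [he] at h
  filter_upwards [h] with ω hω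
  refine hω.congr fun n => ?_
  rw [Finset.sum_range]

variable [NeZero d] [IsProbabilityMeasure P] [IsProbabilityMeasure ν]

theorem ae_injective_eval_zero [NullSingletonClass (ν.map fun x => x 0)]
    (hX : ∀ i, Measurable (X i)) (hlaw : ∀ i, P.map (X i) = ν) (hindep : iIndepFun X P) :
    ∀ᵐ ω ∂P, Function.Injective fun i => X i ω 0 := by
  have hX0 : ∀ i, Measurable fun ω => X i ω 0 := fun i => (measurable_pi_apply 0).comp (hX i)
  have hlaw0 : ∀ i, P.map (fun ω => X i ω 0) = ν.map fun x => x 0 := fun i => by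
    rw [← hlaw i, Measure.map_map (measurable_pi_apply 0) (hX i)]
    rfl
  have hne : ∀ i j, i ≠ j → ∀ᵐ ω ∂P, X i ω 0 ≠ X j ω 0 := fun i j hij => by
    have hind : IndepFun (fun ω => X i ω 0) (fun ω => X j ω 0) P :=
      (hindep.indepFun hij).comp (measurable_pi_apply 0) (measurable_pi_apply 0)
    have hprod := (indepFun_iff_map_prod_eq_prod_map_map (hX0 i).aemeasurable
      (hX0 j).aemeasurable).1 hind
    rw [hlaw0, hlaw0] at hprod
    have hd : MeasurableSet {p : ℝ × ℝ | p.1 = p.2} :=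
      measurableSet_eq_fun measurable_fst measurable_snd
    -- By Fubini the diagonal is null, its sections being singletons of an atomless law.
    have h0 : ((ν.map fun x => x 0).prod (ν.map fun x => x 0)) {p : ℝ × ℝ | p.1 = p.2} = 0 := by
      rw [Measure.prod_apply hd]
      simp [Set.preimage]
    rw [← hprod, Measure.map_apply ((hX0 i).prodMk (hX0 j)) hd] at h0
    exact measure_eq_zero_iff_ae_notMem.1 h0
  have hall : ∀ᵐ ω ∂P, ∀ i j, i ≠ j → X i ω 0 ≠ X j ω 0 := by
    simp only [ae_all_iff]
    exact hne
  filter_upwards [hall] with ω hω i j hij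
  by_contra h
  exact hω i j h hij

theorem ae_isTypical [NullSingletonClass (ν.map fun x => x 0)]
    (hint : Integrable (fun x => x) ν) (hX : ∀ i, Measurable (X i))
    (hlaw : ∀ i, P.map (X i) = ν) (hindep : iIndepFun X P) (r : ℕ) :
    ∀ᵐ ω ∂P, IsTypical ν r fun i => X i ω := by
  -- Rational levels are countably many, so one null set serves for all of them.
  have hcdf : ∀ᵐ ω ∂P, ∀ m j : ℕ, Tendsto
      (fun n : ℕ => firstCdf (empiricalMeasure fun i : Fin n => X i ω)
        (quantile (ν.map fun y => y 0) ((j : ℝ) / m))) atTop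
      (𝓝 (firstCdf ν (quantile (ν.map fun y => y 0) ((j : ℝ) / m)))) := by
    simp only [ae_all_iff]
    intro m j
    set a := quantile (ν.map fun y => y 0) ((j : ℝ) / m)
    have hs : MeasurableSet {x : Fin d → ℝ | x 0 ∈ Set.Iic a} :=
      measurable_pi_apply 0 measurableSet_Iic
    have h := ae_tendsto_average hX hlaw hindep (g := {x : Fin d → ℝ | x 0 ∈ Set.Iic a}.indicator 1)
      (measurable_one.indicator hs) ((integrable_const (1 : ℝ)).indicator hs)
    have he : firstCdf ν a = ν.real {x : Fin d → ℝ | x 0 ∈ Set.Iic a} :=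
      map_measureReal_apply (measurable_pi_apply 0) measurableSet_Iic
    rw [integral_indicator_one hs, ← he] at h
    filter_upwards [h] with ω hω
    refine hω.congr fun n => ?_
    rw [firstCdf, map_real_empiricalMeasure _ measurableSet_Iic, smul_eq_mul]
    rfl
  have hm : Measurable fun x : Fin d → ℝ => legendre r (firstCdf ν (x 0)) • x :=
    ((continuous_legendre r).measurable.comp
      (measurable_firstCdf.comp (measurable_pi_apply 0))).smul measurable_id
  filter_upwards [ae_injective_eval_zero hX hlaw hindep, hcdf,
    ae_tendsto_average hX hlaw hindep measurable_norm hint.norm,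
    ae_tendsto_average hX hlaw hindep hm (integrable_legendre_firstCdf_smul hint r)]
    with ω h1 h2 h3 h4
  exact ⟨h1, h3, h4, h2⟩

end Probabilistic

end LMoment

theorem mainTheorem8 {d : ℕ} [NeZero d] {Ω : Type*} [MeasurableSpace Ω]
    (P : Measure Ω) [IsProbabilityMeasure P]
    (ν : Measure (Fin d → ℝ)) [IsProbabilityMeasure ν]
    (hac : ν ≪ volume) (hint : Integrable (fun x => x) ν)
    (X : ℕ → Ω → Fin d → ℝ) (hX : ∀ i, Measurable (X i))
    (hlaw : ∀ i, P.map (X i) = ν) (hindep : iIndepFun X P)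
    (r : ℕ) (hr : 1 ≤ r) :
    LMoment.HasLMoment (LMoment.quantileGivenFirst ν) (LMoment.firstIndex d r) ∧
    LMoment.HasLMoment (LMoment.rosenblattQuantile ν) (LMoment.firstIndex d r) ∧
    (∀ᵐ ω ∂P, ∀ n : ℕ, 1 ≤ n →
      LMoment.HasLMoment
        (LMoment.rosenblattQuantile (LMoment.empiricalMeasure fun i : Fin n => X i ω))
        (LMoment.firstIndex d r)) ∧
    (∀ᵐ ω ∂P, Tendsto
      (fun n : ℕ => LMoment.plugInLMoment (fun i : Fin n => X i ω) (LMoment.firstIndex d r))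
      atTop
      (𝓝 (LMoment.lMoment (LMoment.quantileGivenFirst ν) (LMoment.firstIndex d r)))) ∧
    (∀ᵐ ω ∂P, Tendsto
      (fun n : ℕ => LMoment.unbiasedLMoment (fun i : Fin n => X i ω) r)
      atTop
      (𝓝 (LMoment.lMoment (LMoment.quantileGivenFirst ν) (LMoment.firstIndex d r)))) ∧
    LMoment.lMoment (LMoment.quantileGivenFirst ν) (LMoment.firstIndex d r) =
      LMoment.lMoment (LMoment.rosenblattQuantile ν) (LMoment.firstIndex d r) := by
  have := LMoment.nullSingletonClass_map_eval hac
  have hG := LMoment.isTransport_quantileGivenFirst ν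
  have hR := LMoment.isTransport_rosenblattQuantile ν
  have hT := LMoment.ae_isTypical hint hX hlaw hindep r
  -- Both L-moments become the same expectation, the limit in `IsTypical`, and the last claim closes
  -- by `rfl`.
  rw [hG.lMoment_eq hint, hR.lMoment_eq hint]
  refine ⟨hG.hasLMoment hint r, hR.hasLMoment hint r, ?_, ?_, ?_, rfl⟩
  · refine Eventually.of_forall fun ω n hn => ?_
    have hn0 : n ≠ 0 := by omega
    have := LMoment.isProbabilityMeasure_empiricalMeasure hn0 fun i : Fin n => X i ω
    exact (LMoment.isTransport_rosenblattQuantile _).hasLMoment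
      (LMoment.integrable_empiricalMeasure _ hn0 _) r
  · filter_upwards [hT] with ω hω using hω.tendsto_plugInLMoment
  · filter_upwards [hT] with ω hω using hω.tendsto_unbiasedLMoment hr
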